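/- Let $0<p<1$ and consider the planar system $$x'=y,\qquad y'=\frac{1}{1-p}\,x-x|x|^{p-1}-\frac12\,\eta\,y ,\qquad (x(0),y(0))=(0,\beta),$$ where $x|x|^{p-1}$ is taken to be $0$ at $x=0$. A solution on an interval $I\ni 0$ is a bounded $C^1$ function $(x,y):I\to\mathbb{R}^2$ satisfying the system on $I$ (one-sided derivatives at end points) and the condition at $\eta=0$. Let $$\Omega=\{(x,y): 0<x<(1-p)^{1/(1-p)},\ y>0\},\qquad \partial\Omega_1=\{(x,y): x=0,\ y>0\}.$$ Let $E_3$ be the set of points $(0,\beta)\in\partial\Omega_1$ for which the system has a unique solution $(x,y):[0,\infty)\to\mathbb{R}^2$ with value $(0,\beta)$ at $\eta=0$ (unique in the sense that, for each $T>0$, every solution on $[0,T]$ with this value at $\eta=0$ coincides with it on $[0,T]$), and this solution satisfies $(x(\eta),y(\eta))\in\Omega$ for all $\eta\in(0,\infty)$ and $(x(\eta),y(\eta))\to\left((1-p)^{1/(1-p)},0\right)$ as $\eta\to\infty$. Then $E_3$ is a non-empty closed subset of $\partial\Omega_1$ (closed in the subspace topology of $\partial\Omega_1\subset\mathbb{R}^2$).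 -/

import Mathlib

open Set Filter Topology

noncomputable section

/-- The right-hand side `(Q₁, Q₂)` of the non-autonomous planar system
`x' = y`, `y' = x / (1 - p) - x |x| ^ (p - 1) - η y / 2`, at the state `q = (x, y)` and time `η`.
(The term `x |x| ^ (p - 1)` is `0` at `x = 0`.) -/
def vectorField (p : ℝ) (q : ℝ × ℝ) (η : ℝ) : ℝ × ℝ :=
  (q.2, 1 / (1 - p) * q.1 - q.1 * |q.1| ^ (p - 1) - 1 / 2 * η * q.2)

/-- `z = (x, y)` is a (classical, bounded) solution of the system on the interval `I`, with
zero-value `z 0 = q`. Derivatives at the end points of `I` are one-sided, and the values of `z`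
outside `I` play no role. For `0 < p` the vector field is continuous, so `z` is automatically
continuously differentiable on `I`. -/
structure IsSolutionOn (p : ℝ) (I : Set ℝ) (q : ℝ × ℝ) (z : ℝ → ℝ × ℝ) : Prop where
  zero_value : z 0 = q
  ode : ∀ η ∈ I, HasDerivWithinAt z (vectorField p (z η) η) I η
  bounded : Bornology.IsBounded (z '' I)

/-- The region `Ω = {(x, y) : 0 < x < (1 - p) ^ (1 / (1 - p)), y > 0}`. -/
def regionOmega (p : ℝ) : Set (ℝ × ℝ) :=
  {q | 0 < q.1 ∧ q.1 < (1 - p) ^ (1 / (1 - p)) ∧ 0 < q.2}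

/-- The half-line `∂Ω₁ = {(x, y) : x = 0, y > 0}`. -/
def halfLine : Set (ℝ × ℝ) :=
  {q | q.1 = 0 ∧ 0 < q.2}

/-- `z` stays in `Ω` at all positive times and converges to `((1 - p) ^ (1 / (1 - p)), 0)`. -/
def StaysAndConverges (p : ℝ) (z : ℝ → ℝ × ℝ) : Prop :=
  (∀ η, 0 < η → z η ∈ regionOmega p) ∧
    Tendsto z atTop (𝓝 ((1 - p) ^ (1 / (1 - p)), 0))

/-- The set `E₃` of the zero-values `q` on the half-line for which the unique solution is defined
on `[0, ∞)`, stays in `Ω` at all positive times and converges to `((1 - p) ^ (1 / (1 - p)), 0)`.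
Uniqueness is meant on every initial time interval: each solution on `[0, T]`
with the same zero-value agrees with `z` there. -/
def setE3 (p : ℝ) : Set (ℝ × ℝ) :=
  {q | q ∈ halfLine ∧ ∃ z : ℝ → ℝ × ℝ,
    IsSolutionOn p (Ici 0) q z ∧
    (∀ T : ℝ, 0 < T → ∀ z' : ℝ → ℝ × ℝ, IsSolutionOn p (Icc 0 T) q z' → EqOn z' z (Icc 0 T)) ∧
    StaysAndConverges p z}

end

/-!
For `0 < p < 1` the set `setE3 p` is a single point, which gives both claims at once: it is
non-empty, and a singleton is closed.

*At most one point.* The system is `x'' + (η / 2) x' = f(x)` with `f(x) = x / (1 - p) - x ^ p` for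
`x ≥ 0`. If two solutions start with `y₁(0) < y₂(0)`, then as long as `x₂ > x₁` the weighted
Wronskian `exp (η² / 4) (x₁ y₂ - x₂ y₁)` increases from `0`, because `f(x) / x` is increasing. Hence
`x₂ / x₁` increases, stays away from `1`, and the two solutions cannot have the same limit
(`strictMonoOn_ratio`, `slope_le_of_staysAndConverges`).

*Existence.* On `[0, κ]`, where `κ = (1 - p) ^ (1 / (1 - p))`, one has `f ≤ 0` and `f' ≤ 1`, so that
`g(η, x) = (η + 7 / 2) x - f(x)` is increasing in `x`. The operator
`D² + (η / 2) D - (η + 7 / 2)` factors as `(D - 2) (D + 2 + η / 2)`, which makes the solution of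
`x'' + (η / 2) x' - (η + 7 / 2) x = -g`, `x(0) = 0`, an explicit monotone double integral
(`greenMap`). The constant `κ` is a supersolution and `κ (1 - exp (-η² / 4))` a subsolution.
Monotone iteration from `κ` therefore converges to a solution between the two (`exists_fixedPoint`),
and this solution tends to `κ`. Since `exp (η² / 4) x'` is nonincreasing and `x < κ`, the derivative
is positive and tends to `0` (`setE3_nonempty`).

*Uniqueness of the initial value problem.* The field is not Lipschitz at `x = 0`, but a solution
leaving the half-line satisfies `x ≥ m η`, so its local Lipschitz constant is of order
`η ^ (p - 1)`. This is integrable at `0`, and a Grönwall argument applies (`solution_unique`).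
-/

/-! ### The nonlinearity -/

/-- The positive equilibrium `(1 - p) ^ (1 / (1 - p))` of the nonlinearity. -/
noncomputable def equilibrium (p : ℝ) : ℝ := (1 - p) ^ (1 / (1 - p))

/-- The autonomous part `x / (1 - p) - x |x| ^ (p - 1)` of the second component of the field. -/
noncomputable def force (p x : ℝ) : ℝ := 1 / (1 - p) * x - x * |x| ^ (p - 1)

section nonlinearity

variable {p : ℝ}

lemma equilibrium_pos (hp1 : p < 1) : 0 < equilibrium p :=
  Real.rpow_pos_of_pos (by linarith) _

lemma equilibrium_rpow (hp1 : p < 1) : equilibrium p ^ (1 - p) = 1 - p := by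
  have h : 0 < 1 - p := by linarith
  rw [equilibrium, ← Real.rpow_mul h.le, one_div_mul_cancel h.ne', Real.rpow_one]

lemma mul_abs_rpow (hp0 : 0 < p) {x : ℝ} (hx : 0 ≤ x) : x * |x| ^ (p - 1) = x ^ p := by
  rcases hx.eq_or_lt with rfl | hx
  · simp [Real.zero_rpow hp0.ne']
  · rw [abs_of_pos hx, Real.rpow_sub_one hx.ne', mul_div_cancel₀ _ hx.ne']

lemma force_of_nonneg (hp0 : 0 < p) {x : ℝ} (hx : 0 ≤ x) :
    force p x = 1 / (1 - p) * x - x ^ p := by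
  rw [force, mul_abs_rpow hp0 hx]

lemma force_neg (hp0 : 0 < p) (hp1 : p < 1) {x : ℝ} (hx : 0 < x) (hx1 : x < equilibrium p) :
    force p x < 0 := by
  have h : 0 < 1 - p := by linarith
  have h1 : x ^ (1 - p) < 1 - p := by
    simpa only [equilibrium_rpow hp1] using Real.rpow_lt_rpow hx.le hx1 h
  have h2 : x = x ^ (1 - p) * x ^ p := by
    rw [← Real.rpow_add hx, sub_add_cancel, Real.rpow_one]
  have h3 : 0 < x ^ p := Real.rpow_pos_of_pos hx p
  rw [force_of_nonneg hp0 hx.le, sub_neg, one_div, inv_mul_lt_iff₀ h]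
  nlinarith

lemma force_equilibrium (hp0 : 0 < p) (hp1 : p < 1) : force p (equilibrium p) = 0 := by
  have h : 0 < 1 - p := by linarith
  have hκ := equilibrium_pos hp1
  have h2 : equilibrium p = equilibrium p ^ (1 - p) * equilibrium p ^ p := by
    rw [← Real.rpow_add hκ, sub_add_cancel, Real.rpow_one]
  rw [force_of_nonneg hp0 hκ.le]
  nth_rewrite 1 [h2]
  rw [equilibrium_rpow hp1]
  field_simp
  ring

lemma force_nonpos (hp0 : 0 < p) (hp1 : p < 1) {x : ℝ} (hx : x ∈ Icc 0 (equilibrium p)) :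
    force p x ≤ 0 := by
  rcases hx.1.eq_or_lt with rfl | h0
  · simp [force]
  rcases hx.2.eq_or_lt with rfl | h1
  · exact (force_equilibrium hp0 hp1).le
  · exact (force_neg hp0 hp1 h0 h1).le

/-- Below the equilibrium the slope of the nonlinearity is at most `1`. -/
lemma monotoneOn_sub_force (hp0 : 0 < p) (hp1 : p < 1) :
    MonotoneOn (fun x => x - (1 / (1 - p) * x - x ^ p)) (Icc 0 (equilibrium p)) := by
  have h : 0 < 1 - p := by linarith
  have hd : ∀ x : ℝ, 0 < x → HasDerivAt (fun x => x - (1 / (1 - p) * x - x ^ p))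
      (1 - (1 / (1 - p) * 1 - p * x ^ (p - 1))) x := fun x hx =>
    (hasDerivAt_id x).sub
      (((hasDerivAt_id x).const_mul _).sub (Real.hasDerivAt_rpow_const (Or.inl hx.ne')))
  refine monotoneOn_of_deriv_nonneg (convex_Icc _ _) ?_ ?_ ?_
  · exact (continuous_id.sub ((continuous_const.mul continuous_id).sub
      (Real.continuous_rpow_const hp0.le))).continuousOn
  · intro x hx
    rw [interior_Icc] at hx
    exact (hd x hx.1).differentiableAt.differentiableWithinAt
  · intro x hx
    rw [interior_Icc] at hx
    rw [(hd x hx.1).deriv]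
    have h1 : x ^ (1 - p) < 1 - p := by
      simpa only [equilibrium_rpow hp1] using Real.rpow_lt_rpow hx.1.le hx.2 h
    have h2 : 1 / (1 - p) ≤ x ^ (p - 1) := by
      rw [← neg_sub 1 p, Real.rpow_neg hx.1.le, one_div]
      exact inv_anti₀ (Real.rpow_pos_of_pos hx.1 _) h1.le
    have h3 : (1 - p) * (1 / (1 - p)) = 1 := mul_one_div_cancel h.ne'
    nlinarith

/-- The odd power `t |t| ^ (p - 1)` is Lipschitz at a point `x > 0`, against all real `t`, with a
constant of order `x ^ (p - 1)`. -/
lemma abs_oddPow_sub_le (hp0 : 0 < p) (hp1 : p < 1) {x : ℝ} (hx : 0 < x) (t : ℝ) :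
    |t * |t| ^ (p - 1) - x ^ p| ≤ 2 * x ^ (p - 1) * |t - x| := by
  have hq : 0 < x ^ (p - 1) := Real.rpow_pos_of_pos hx _
  have hxp : x ^ p = x * x ^ (p - 1) := by
    rw [Real.rpow_sub_one hx.ne', mul_div_cancel₀ _ hx.ne']
  rcases eq_or_ne t 0 with rfl | ht
  · simp only [zero_mul, zero_sub, abs_neg]
    rw [hxp, abs_of_pos (mul_pos hx hq), abs_of_pos hx]
    nlinarith [mul_pos hx hq]
  have htp : 0 < |t| ^ (p - 1) := Real.rpow_pos_of_pos (abs_pos.2 ht) _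
  -- comparing the weights `|t| ^ (p - 1)` and `x ^ (p - 1)` bounds `|t| ^ p`
  have hlow : |t| ≤ x → |t| * |t| ^ (p - 1) ≤ x * x ^ (p - 1) ∧ x ^ (p - 1) ≤ |t| ^ (p - 1) := by
    intro h
    refine ⟨?_, Real.rpow_le_rpow_of_nonpos (abs_pos.2 ht) h (by linarith)⟩
    rw [← hxp, Real.rpow_sub_one (abs_pos.2 ht).ne', mul_div_cancel₀ _ (abs_pos.2 ht).ne']
    exact Real.rpow_le_rpow (abs_nonneg t) h hp0.le
  have hhigh : x ≤ |t| → x * x ^ (p - 1) ≤ |t| * |t| ^ (p - 1) ∧ |t| ^ (p - 1) ≤ x ^ (p - 1) := by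
    intro h
    refine ⟨?_, Real.rpow_le_rpow_of_nonpos hx h (by linarith)⟩
    rw [← hxp, Real.rpow_sub_one (abs_pos.2 ht).ne', mul_div_cancel₀ _ (abs_pos.2 ht).ne']
    exact Real.rpow_le_rpow hx.le h hp0.le
  rw [hxp]
  rcases le_total 0 t with h0 | h0 <;> rcases le_total |t| x with h1 | h1
  · obtain ⟨ha, hb⟩ := hlow h1
    rw [abs_of_nonneg h0] at *
    rw [abs_of_nonpos (by linarith), abs_of_nonpos (by linarith)]
    nlinarith
  · obtain ⟨ha, hb⟩ := hhigh h1
    rw [abs_of_nonneg h0] at *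
    rw [abs_of_nonneg (by linarith), abs_of_nonneg (by linarith)]
    nlinarith
  · obtain ⟨ha, hb⟩ := hlow h1
    rw [abs_of_nonpos h0] at *
    have h4 : t * (-t) ^ (p - 1) ≤ 0 := mul_nonpos_of_nonpos_of_nonneg h0 htp.le
    rw [abs_of_nonpos (by nlinarith [mul_pos hx hq]), abs_of_nonpos (by linarith)]
    nlinarith
  · obtain ⟨ha, hb⟩ := hhigh h1
    rw [abs_of_nonpos h0] at *
    have h4 : t * (-t) ^ (p - 1) ≤ 0 := mul_nonpos_of_nonpos_of_nonneg h0 htp.le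
    rw [abs_of_nonpos (by nlinarith [mul_pos hx hq]), abs_of_nonpos (by linarith)]
    nlinarith

lemma abs_force_sub_le (hp0 : 0 < p) (hp1 : p < 1) {x : ℝ} (hx : 0 < x) (t : ℝ) :
    |force p t - force p x| ≤ (1 / (1 - p) + 2 * x ^ (p - 1)) * |t - x| := by
  have h : 0 < 1 / (1 - p) := one_div_pos.2 (by linarith)
  have h1 := abs_oddPow_sub_le hp0 hp1 hx t
  have h2 : force p t - force p x =
      1 / (1 - p) * (t - x) - (t * |t| ^ (p - 1) - x ^ p) := by
    rw [force_of_nonneg hp0 hx.le, force]; ring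
  rw [h2]
  refine (abs_sub _ _).trans ?_
  rw [abs_mul, abs_of_pos h]
  linarith

end nonlinearity

/-! ### Solutions through the half-line are unique -/

section solutions

variable {p : ℝ} {I : Set ℝ} {q : ℝ × ℝ} {z : ℝ → ℝ × ℝ}

lemma IsSolutionOn.hasDerivAt (h : IsSolutionOn p I q z) {η : ℝ} (hη : I ∈ 𝓝 η) :
    HasDerivAt (fun s => (z s).1) (z η).2 η ∧
      HasDerivAt (fun s => (z s).2) (force p (z η).1 - 1 / 2 * η * (z η).2) η := by
  have h1 := (h.ode η (mem_of_mem_nhds hη)).hasDerivAt hη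
  exact ⟨h1.fst, h1.snd⟩

lemma IsSolutionOn.continuousOn (h : IsSolutionOn p I q z) : ContinuousOn z I :=
  fun η hη => (h.ode η hη).continuousWithinAt

lemma IsSolutionOn.mono {J : Set ℝ} (h : IsSolutionOn p I q z) (hJ : J ⊆ I) :
    IsSolutionOn p J q z :=
  ⟨h.zero_value, fun η hη => (h.ode η (hJ hη)).mono hJ, h.bounded.subset (image_mono hJ)⟩

/-- A solution starting on the half-line and entering `Ω` leaves the axis at a linear rate. -/
lemma exists_linear_lower_bound {T : ℝ} (hT : 0 < T) (h : IsSolutionOn p (Icc 0 T) q z)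
    (hq : q ∈ halfLine) (hpos : ∀ η ∈ Ioc 0 T, 0 < (z η).2) :
    ∃ m > 0, ∀ η ∈ Icc 0 T, m * η ≤ (z η).1 := by
  have hc := h.continuousOn
  obtain ⟨a, ha, hmin⟩ := isCompact_Icc.exists_isMinOn (nonempty_Icc.2 hT.le) hc.snd
  have hapos : 0 < (z a).2 := by
    rcases ha.1.eq_or_lt with h0 | h0
    · rw [← h0, h.zero_value]; exact hq.2
    · exact hpos a ⟨h0, ha.2⟩
  refine ⟨(z a).2, hapos, fun η hη => ?_⟩
  have hmono : MonotoneOn (fun s => (z s).1 - (z a).2 * s) (Icc 0 T) := by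
    have hd : ∀ s ∈ Ioo 0 T, HasDerivAt (fun s => (z s).1 - (z a).2 * s)
        ((z s).2 - (z a).2 * 1) s := fun s hs =>
      (h.hasDerivAt (Icc_mem_nhds hs.1 hs.2)).1.sub ((hasDerivAt_id s).const_mul _)
    refine monotoneOn_of_deriv_nonneg (convex_Icc _ _)
      (hc.fst.sub (continuousOn_const.mul continuousOn_id)) ?_ ?_ <;> rw [interior_Icc]
    · exact fun s hs => (hd s hs).differentiableAt.differentiableWithinAt
    · intro s hs
      rw [(hd s hs).deriv]
      have : (z a).2 ≤ (z s).2 := hmin ⟨hs.1.le, hs.2.le⟩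
      linarith
  have h0 := hmono (left_mem_Icc.2 hT.le) hη hη.1
  have h1 : (z 0).1 = 0 := by rw [h.zero_value]; exact hq.1
  simp only [h1, mul_zero, sub_zero] at h0
  linarith

/-- The squared distance `V` between two solutions satisfies `V' ≤ k V`, where the weight
`k η ~ η ^ (p - 1)` is singular but integrable at `0`; hence `V = 0`. -/
lemma solution_unique (hp0 : 0 < p) (hp1 : p < 1) {T : ℝ} (hT : 0 < T)
    (h : IsSolutionOn p (Icc 0 T) q z) (hq : q ∈ halfLine)
    (hΩ : ∀ η ∈ Ioc 0 T, z η ∈ regionOmega p) {z' : ℝ → ℝ × ℝ}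
    (h' : IsSolutionOn p (Icc 0 T) q z') : EqOn z' z (Icc 0 T) := by
  obtain ⟨m, hm, hlin⟩ := exists_linear_lower_bound hT h hq fun η hη => (hΩ η hη).2.2
  have hcpos : 0 < 1 / (1 - p) := one_div_pos.2 (by linarith)
  set c := 1 / (1 - p) with hc
  set C := 2 * m ^ (p - 1) with hC
  have hCpos : 0 < C := mul_pos two_pos (Real.rpow_pos_of_pos hm _)
  -- `K` is a primitive of the weight `1 + c + C η ^ (p - 1)`
  let K : ℝ → ℝ := fun η => (1 + c) * η + C / p * η ^ p
  let V : ℝ → ℝ := fun η => ((z' η).1 - (z η).1) ^ 2 + ((z' η).2 - (z η).2) ^ 2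
  have hK : ∀ η, 0 < η → HasDerivAt K (1 + c + C * η ^ (p - 1)) η := by
    intro η hη
    refine (((hasDerivAt_id η).const_mul (1 + c)).add
      ((Real.hasDerivAt_rpow_const (Or.inl hη.ne')).const_mul (C / p))).congr_deriv ?_
    field_simp
  have hKc : Continuous K := (continuous_const.mul continuous_id).add
    (continuous_const.mul (Real.continuous_rpow_const hp0.le))
  have hVc : ContinuousOn V (Icc 0 T) :=
    ((h'.continuousOn.fst.sub h.continuousOn.fst).pow 2).add
      ((h'.continuousOn.snd.sub h.continuousOn.snd).pow 2)
  have hV : ∀ η ∈ Ioo 0 T, ∃ v, HasDerivAt V v η ∧ v ≤ (1 + c + C * η ^ (p - 1)) * V η := by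
    intro η hη
    obtain ⟨hx, hy⟩ := h.hasDerivAt (Icc_mem_nhds hη.1 hη.2)
    obtain ⟨hx', hy'⟩ := h'.hasDerivAt (Icc_mem_nhds hη.1 hη.2)
    refine ⟨_, ((hx'.sub hx).pow 2).add ((hy'.sub hy).pow 2), ?_⟩
    have hF := abs_force_sub_le hp0 hp1 (hΩ η ⟨hη.1, hη.2.le⟩).1 (z' η).1
    have hw : 2 * (z η).1 ^ (p - 1) ≤ C * η ^ (p - 1) := by
      rw [hC, mul_assoc, ← Real.mul_rpow hm.le hη.1.le]
      exact mul_le_mul_of_nonneg_left (Real.rpow_le_rpow_of_nonpos (mul_pos hm hη.1)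
        (hlin η ⟨hη.1.le, hη.2.le⟩) (by linarith)) two_pos.le
    have hkpos : 0 < C * η ^ (p - 1) := mul_pos hCpos (Real.rpow_pos_of_pos hη.1 _)
    simp only [V, Pi.sub_apply]
    set k := C * η ^ (p - 1)
    set F := force p (z' η).1 - force p (z η).1 with hFdef
    set d := (z' η).1 - (z η).1 with hd
    set e := (z' η).2 - (z η).2 with he
    have hF' : |F| ≤ (c + k) * |d| :=
      hF.trans (mul_le_mul_of_nonneg_right (by linarith) (abs_nonneg _))
    have h1 : e * F ≤ (c + k) * (|d| * |e|) := by
      calc e * F ≤ |e| * |F| := by rw [← abs_mul]; exact le_abs_self _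
        _ ≤ |e| * ((c + k) * |d|) := mul_le_mul_of_nonneg_left hF' (abs_nonneg _)
        _ = _ := by ring
    have h2 : 2 * (|d| * |e|) ≤ d ^ 2 + e ^ 2 := by
      nlinarith [sq_nonneg (|d| - |e|), sq_abs d, sq_abs e]
    have h3 : 2 * (d * e) ≤ d ^ 2 + e ^ 2 := by nlinarith [sq_nonneg (d - e)]
    have h4 : 0 ≤ η * e ^ 2 := mul_nonneg hη.1.le (sq_nonneg e)
    have h5 : (c + k) * (2 * (|d| * |e|)) ≤ (c + k) * (d ^ 2 + e ^ 2) :=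
      mul_le_mul_of_nonneg_left h2 (by linarith)
    have h6 : force p (z' η).1 - 1 / 2 * η * (z' η).2 - (force p (z η).1 - 1 / 2 * η * (z η).2)
        = F - 1 / 2 * η * e := by rw [hFdef, he]; ring
    rw [h6]
    norm_num
    nlinarith
  have hanti : AntitoneOn (fun η => V η * Real.exp (-K η)) (Icc 0 T) := by
    refine antitoneOn_of_deriv_nonpos (convex_Icc _ _)
      (hVc.mul (Real.continuous_exp.comp hKc.neg).continuousOn) ?_ ?_ <;> rw [interior_Icc] <;>
      intro η hη <;> obtain ⟨v, hv, hle⟩ := hV η hη <;>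
      have hd := hv.mul (hK η hη.1).neg.exp
    · exact hd.differentiableAt.differentiableWithinAt
    · have : deriv (fun η => V η * Real.exp (-K η)) η = _ := hd.deriv
      rw [this]
      have := Real.exp_pos (-K η)
      simp only [Pi.neg_apply]
      nlinarith
  intro η hη
  have h0 := hanti (left_mem_Icc.2 hT.le) hη hη.1
  have hV0 : V 0 = 0 := by simp only [V, h.zero_value, h'.zero_value]; ring
  simp only [hV0, zero_mul] at h0
  have hVη : V η ≤ 0 := nonpos_of_mul_nonpos_left h0 (Real.exp_pos _)
  have h1 : (z' η).1 - (z η).1 = 0 := by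
    simp only [V] at hVη; nlinarith [sq_nonneg ((z' η).1 - (z η).1), sq_nonneg ((z' η).2 - (z η).2)]
  have h2 : (z' η).2 - (z η).2 = 0 := by
    simp only [V] at hVη; nlinarith [sq_nonneg ((z' η).1 - (z η).1), sq_nonneg ((z' η).2 - (z η).2)]
  exact Prod.ext (sub_eq_zero.1 h1) (sub_eq_zero.1 h2)

/-! ### At most one initial slope connects to the equilibrium -/

/-- As long as `x₂ > x₁`, the Wronskian `exp (η² / 4) (x₁ y₂ - x₂ y₁)` increases from `0`, because
`force p x / x = 1 / (1 - p) - x ^ (p - 1)` is increasing in `x`; so the ratio `x₂ / x₁`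
increases. -/
lemma strictMonoOn_ratio (hp1 : p < 1) {q₁ q₂ : ℝ × ℝ} {z₁ z₂ : ℝ → ℝ × ℝ} {b : ℝ}
    (h₁ : IsSolutionOn p (Ici 0) q₁ z₁) (h₂ : IsSolutionOn p (Ici 0) q₂ z₂)
    (hq₁ : q₁.1 = 0) (hq₂ : q₂.1 = 0) (hpos : ∀ η, 0 < η → 0 < (z₁ η).1)
    (hlt : ∀ η, 0 < η → η < b → (z₁ η).1 < (z₂ η).1) :
    StrictMonoOn (fun η => (z₂ η).1 / (z₁ η).1) (Ioc 0 b) := by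
  let w : ℝ → ℝ := fun η =>
    Real.exp (η ^ 2 / 4) * ((z₁ η).1 * (z₂ η).2 - (z₂ η).1 * (z₁ η).2)
  have hIcc : Icc 0 b ⊆ Ici 0 := fun η hη => hη.1
  have hc₁ := h₁.continuousOn.mono hIcc
  have hc₂ := h₂.continuousOn.mono hIcc
  have hw : StrictMonoOn w (Icc 0 b) := by
    refine strictMonoOn_of_deriv_pos (convex_Icc _ _) ?_ ?_
    · exact (by fun_prop : Continuous fun η : ℝ => Real.exp (η ^ 2 / 4)).continuousOn.mul
        ((hc₁.fst.mul hc₂.snd).sub (hc₂.fst.mul hc₁.snd))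
    · intro η hη
      rw [interior_Icc] at hη
      obtain ⟨hx₁, hy₁⟩ := h₁.hasDerivAt (Ici_mem_nhds hη.1)
      obtain ⟨hx₂, hy₂⟩ := h₂.hasDerivAt (Ici_mem_nhds hη.1)
      have hexp : HasDerivAt (fun η : ℝ => Real.exp (η ^ 2 / 4))
          (Real.exp (η ^ 2 / 4) * (η / 2)) η := by
        refine (((hasDerivAt_id η).pow 2).div_const 4).exp.congr_deriv ?_
        simp; ring
      have hd := hexp.mul ((hx₁.mul hy₂).sub (hx₂.mul hy₁))
      have hd' : deriv w η = _ := hd.deriv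
      have hx1 := hpos η hη.1
      have hx12 := hlt η hη.1 hη.2
      have hx2 := hx1.trans hx12
      have hpow : (z₂ η).1 ^ (p - 1) < (z₁ η).1 ^ (p - 1) :=
        Real.rpow_lt_rpow_of_neg hx1 hx12 (by linarith)
      rw [hd']
      simp only [force, abs_of_pos hx1, abs_of_pos hx2, Pi.sub_apply, Pi.mul_apply]
      have hE := Real.exp_pos (η ^ 2 / 4)
      set E := Real.exp (η ^ 2 / 4)
      have key : 0 < E * ((z₁ η).1 * (z₂ η).1 * ((z₁ η).1 ^ (p - 1) - (z₂ η).1 ^ (p - 1))) :=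
        mul_pos hE (mul_pos (mul_pos hx1 hx2) (sub_pos.2 hpow))
      nlinarith [key]
  refine strictMonoOn_of_deriv_pos (convex_Ioc _ _) ?_ ?_
  · exact (hc₂.fst.mono Ioc_subset_Icc_self).div (hc₁.fst.mono Ioc_subset_Icc_self)
      fun η hη => (hpos η hη.1).ne'
  · intro η hη
    rw [interior_Ioc] at hη
    obtain ⟨hx₁, -⟩ := h₁.hasDerivAt (Ici_mem_nhds hη.1)
    obtain ⟨hx₂, -⟩ := h₂.hasDerivAt (Ici_mem_nhds hη.1)
    have hd := hx₂.div hx₁ (hpos η hη.1).ne'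
    have hd' : deriv (fun η => (z₂ η).1 / (z₁ η).1) η = _ := hd.deriv
    rw [hd']
    refine div_pos ?_ (pow_pos (hpos η hη.1) 2)
    have h0 : w 0 < w η := hw (left_mem_Icc.2 (hη.1.trans hη.2).le) ⟨hη.1.le, hη.2.le⟩ hη.1
    have hw0 : w 0 = 0 := by simp [w, h₁.zero_value, h₂.zero_value, hq₁, hq₂]
    rw [hw0] at h0
    have := (mul_pos_iff_of_pos_left (Real.exp_pos _)).1 h0
    linarith

/-- A larger initial slope keeps the first component larger by a fixed factor, so both solutions
cannot have the same limit. -/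
lemma slope_le_of_staysAndConverges (hp1 : p < 1) {q₁ q₂ : ℝ × ℝ}
    {z₁ z₂ : ℝ → ℝ × ℝ}
    (h₁ : IsSolutionOn p (Ici 0) q₁ z₁) (h₂ : IsSolutionOn p (Ici 0) q₂ z₂)
    (hq₁ : q₁.1 = 0) (hq₂ : q₂.1 = 0)
    (hs₁ : StaysAndConverges p z₁) (hs₂ : StaysAndConverges p z₂) : q₂.2 ≤ q₁.2 := by
  by_contra! hlt
  have hpos : ∀ η, 0 < η → 0 < (z₁ η).1 := fun η hη => (hs₁.1 η hη).1
  -- `x₂ > x₁` on a right neighbourhood `(0, ε]` of `0`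
  obtain ⟨ε, hε, hinit⟩ : ∃ ε > 0, ∀ η, 0 < η → η ≤ ε → (z₁ η).1 < (z₂ η).1 := by
    have hd : ContinuousOn (fun η => (z₂ η).2 - (z₁ η).2) (Ici 0) :=
      h₂.continuousOn.snd.sub h₁.continuousOn.snd
    have h0 : 0 < (fun η => (z₂ η).2 - (z₁ η).2) 0 := by
      simp only [h₁.zero_value, h₂.zero_value]; linarith
    have hev := (hd 0 self_mem_Ici).eventually (lt_mem_nhds h0)
    obtain ⟨δ, hδ, hδ'⟩ := mem_nhdsGE_iff_exists_Ico_subset.1 hev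
    have hδ0 : (0 : ℝ) < δ := hδ
    refine ⟨δ / 2, by positivity, fun η hη hηδ => ?_⟩
    have hmono : StrictMonoOn (fun η => (z₂ η).1 - (z₁ η).1) (Icc 0 η) := by
      have hsub : Icc 0 η ⊆ Ici 0 := fun s hs => hs.1
      refine strictMonoOn_of_deriv_pos (convex_Icc _ _)
        ((h₂.continuousOn.fst.mono hsub).sub (h₁.continuousOn.fst.mono hsub)) fun s hs => ?_
      rw [interior_Icc] at hs
      have := ((h₂.hasDerivAt (Ici_mem_nhds hs.1)).1.sub (h₁.hasDerivAt (Ici_mem_nhds hs.1)).1).deriv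
      have h3 : deriv (fun η => (z₂ η).1 - (z₁ η).1) s = _ := this
      rw [h3]
      exact hδ' ⟨hs.1.le, by linarith [hs.2]⟩
    have := hmono (left_mem_Icc.2 hη.le) (right_mem_Icc.2 hη.le) hη
    simp only [h₁.zero_value, h₂.zero_value, hq₁, hq₂, sub_self] at this
    linarith
  have hall : ∀ η, 0 < η → (z₁ η).1 < (z₂ η).1 := by
    by_contra! hne
    obtain ⟨t, ht, hle⟩ := hne
    -- the first time `b` at which `x₂ > x₁` fails
    let S : Set ℝ := Icc ε t ∩ {η | (z₂ η).1 - (z₁ η).1 ≤ 0}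
    have hεt : ε < t := by
      by_contra! h
      exact absurd (hinit t ht h) (not_lt.2 hle)
    have hsub : Icc ε t ⊆ Ici 0 := fun s hs => hε.le.trans hs.1
    have hcl : IsClosed S := ((h₂.continuousOn.fst.mono hsub).sub
      (h₁.continuousOn.fst.mono hsub)).preimage_isClosed_of_isClosed isClosed_Icc isClosed_Iic
    have hne : S.Nonempty := ⟨t, ⟨hεt.le, le_rfl⟩, sub_nonpos.2 hle⟩
    have hbdd : BddBelow S := ⟨ε, fun s hs => hs.1.1⟩
    have hb := hcl.csInf_mem hne hbdd
    set b := sInf S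
    have hb0 : 0 < b := hε.trans_le hb.1.1
    have hbefore : ∀ η, 0 < η → η < b → (z₁ η).1 < (z₂ η).1 := by
      intro η hη hηb
      by_contra! h
      rcases le_total η ε with h' | h'
      · exact absurd (hinit η hη h') (not_lt.2 h)
      · exact absurd (csInf_le hbdd ⟨⟨h', hηb.le.trans hb.1.2⟩, sub_nonpos.2 h⟩) (not_le.2 hηb)
    have hr := strictMonoOn_ratio hp1 h₁ h₂ hq₁ hq₂ hpos hbefore
      (⟨by positivity, by linarith⟩ : b / 2 ∈ Ioc 0 b) ⟨hb0, le_rfl⟩ (by linarith)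
    have hb2 : 0 < b / 2 := by positivity
    have h1 : 1 < (z₂ (b / 2)).1 / (z₁ (b / 2)).1 :=
      (one_lt_div (hpos _ hb2)).2 (hbefore _ hb2 (by linarith))
    have h2 : (z₂ b).1 / (z₁ b).1 ≤ 1 := (div_le_one (hpos b hb0)).2 (sub_nonpos.1 hb.2)
    exact absurd (h1.trans hr) (not_lt.2 h2)
  have h1 : 1 < (z₂ 1).1 / (z₁ 1).1 := (one_lt_div (hpos _ one_pos)).2 (hall 1 one_pos)
  have hκ : equilibrium p ≠ 0 := (equilibrium_pos hp1).ne'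
  have hlim : Tendsto (fun η => (z₂ η).1 / (z₁ η).1) atTop (𝓝 1) := by
    have h : Tendsto (fun η => (z₂ η).1 / (z₁ η).1) atTop (𝓝 (equilibrium p / equilibrium p)) :=
      hs₂.2.fst_nhds.div hs₁.2.fst_nhds hκ
    rwa [div_self hκ] at h
  have hge : (z₂ 1).1 / (z₁ 1).1 ≤ 1 := by
    refine ge_of_tendsto hlim (eventually_ge_atTop 1 |>.mono fun η hη => ?_)
    exact (strictMonoOn_ratio hp1 h₁ h₂ hq₁ hq₂ hpos fun s hs _ => hall s hs).monotoneOn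
      (⟨one_pos, hη⟩ : (1 : ℝ) ∈ Ioc 0 η) ⟨by linarith, le_rfl⟩ hη
  linarith

lemma setE3_subsingleton (hp1 : p < 1) : (setE3 p).Subsingleton := by
  rintro q₁ ⟨hq₁, z₁, h₁, -, hs₁⟩ q₂ ⟨hq₂, z₂, h₂, -, hs₂⟩
  exact Prod.ext (hq₁.1.trans hq₂.1.symm)
    ((slope_le_of_staysAndConverges hp1 h₂ h₁ hq₂.1 hq₁.1 hs₂ hs₁).antisymm
      (slope_le_of_staysAndConverges hp1 h₁ h₂ hq₁.1 hq₂.1 hs₁ hs₂))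

end solutions

/-! ### A monotone integral operator -/

section operator

variable {p : ℝ}

/-- The source `g(s, x) = (s + 7 / 2) x - force p x` of the equation
`x'' + (s / 2) x' - (s + 7 / 2) x = -g(s, x)`, with `x` clamped to `[0, equilibrium p]` and `s`
replaced by `|s|`, so that it is nonnegative and monotone in `x` for all real arguments. -/
noncomputable def source (p s x : ℝ) : ℝ :=
  (|s| + 5 / 2) * max 0 (min (equilibrium p) x) +
    (max 0 (min (equilibrium p) x) -
      (1 / (1 - p) * max 0 (min (equilibrium p) x) - max 0 (min (equilibrium p) x) ^ p))

lemma clamp_mem (hp1 : p < 1) (x : ℝ) :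
    max 0 (min (equilibrium p) x) ∈ Icc 0 (equilibrium p) :=
  ⟨le_max_left _ _, max_le (equilibrium_pos hp1).le (min_le_left _ _)⟩

lemma clamp_of_mem {x : ℝ} (hx : x ∈ Icc 0 (equilibrium p)) :
    max 0 (min (equilibrium p) x) = x := by
  rw [min_eq_right hx.2, max_eq_right hx.1]

lemma source_of_mem (hp0 : 0 < p) {s x : ℝ} (hs : 0 ≤ s) (hx : x ∈ Icc 0 (equilibrium p)) :
    source p s x = (s + 7 / 2) * x - force p x := by
  rw [source, clamp_of_mem hx, abs_of_nonneg hs, force_of_nonneg hp0 hx.1]; ring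

lemma source_mono (hp0 : 0 < p) (hp1 : p < 1) (s : ℝ) : Monotone (source p s) := by
  intro x y hxy
  have h : max 0 (min (equilibrium p) x) ≤ max 0 (min (equilibrium p) y) :=
    max_le_max le_rfl (min_le_min le_rfl hxy)
  exact add_le_add (mul_le_mul_of_nonneg_left h (by positivity))
    (monotoneOn_sub_force hp0 hp1 (clamp_mem hp1 x) (clamp_mem hp1 y) h)

lemma continuous_source (hp0 : 0 < p) : Continuous fun v : ℝ × ℝ => source p v.1 v.2 := by
  have h := Real.continuous_rpow_const hp0.le
  unfold source
  fun_prop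

lemma source_nonneg (hp0 : 0 < p) (hp1 : p < 1) (s x : ℝ) : 0 ≤ source p s x := by
  have h0 : source p s (min 0 x) = 0 := by
    simp [source, Real.zero_rpow hp0.ne']
  exact h0 ▸ source_mono hp0 hp1 s (min_le_right 0 x)

lemma source_le (hp0 : 0 < p) (hp1 : p < 1) (s x : ℝ) :
    source p s x ≤ (|s| + 7 / 2) * equilibrium p := by
  have hκ := equilibrium_pos hp1
  have h1 := source_mono hp0 hp1 s (le_max_right (equilibrium p) x)
  refine h1.trans (le_of_eq ?_)
  have h2 := force_equilibrium hp0 hp1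
  rw [force_of_nonneg hp0 hκ.le] at h2
  rw [source, min_eq_left (le_max_left _ _), max_eq_right hκ.le, h2]
  ring

lemma integrableOn_exp_mul_linear (a : ℝ) :
    MeasureTheory.IntegrableOn
      (fun s => Real.exp (-2 * s) * ((|s| + 7 / 2) * equilibrium p)) (Ioi a) := by
  refine integrable_of_isBigO_exp_neg (b := 1) one_pos (by fun_prop) ?_
  refine Asymptotics.IsBigO.of_bound (7 / 2 * |equilibrium p|)
    ((eventually_ge_atTop 0).mono fun s hs => ?_)
  have h1 : s + 1 ≤ Real.exp s := Real.add_one_le_exp s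
  have h2 : Real.exp (-2 * s) * Real.exp s = Real.exp (-1 * s) := by
    rw [← Real.exp_add]; congr 1; ring
  have h3 := Real.exp_pos (-2 * s)
  rw [Real.norm_eq_abs, Real.norm_eq_abs, abs_mul, abs_mul, Real.abs_exp, Real.abs_exp, ← h2,
    abs_of_nonneg hs, abs_of_nonneg (by linarith : 0 ≤ s + 7 / 2)]
  calc Real.exp (-2 * s) * ((s + 7 / 2) * |equilibrium p|)
      ≤ Real.exp (-2 * s) * (7 / 2 * Real.exp s * |equilibrium p|) := by
        gcongr; linarith
    _ = _ := by ring

lemma integrableOn_exp_mul_source (hp0 : 0 < p) (hp1 : p < 1) {x : ℝ → ℝ} (hx : Measurable x)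
    (a : ℝ) : MeasureTheory.IntegrableOn
      (fun s => Real.exp (-2 * s) * source p s (x s)) (Ioi a) := by
  refine (integrableOn_exp_mul_linear (p := p) a).mono' ?_ (Eventually.of_forall fun s => ?_)
  · exact ((by fun_prop : Measurable fun s : ℝ => Real.exp (-2 * s)).mul
      ((continuous_source hp0).measurable.comp (measurable_id.prodMk hx))).aestronglyMeasurable
  · rw [Real.norm_eq_abs, abs_mul, Real.abs_exp, abs_of_nonneg (source_nonneg hp0 hp1 _ _)]
    exact mul_le_mul_of_nonneg_left (source_le hp0 hp1 _ _) (Real.exp_pos _).le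

/-- The solution `w` of `w' = 2 w - source p η (x η)` that does not grow exponentially. -/
noncomputable def outer (p : ℝ) (x : ℝ → ℝ) (η : ℝ) : ℝ :=
  Real.exp (2 * η) * ∫ s in Ioi η, Real.exp (-2 * s) * source p s (x s)

/-- The solution `u` of `u' = -(2 + η / 2) u + outer p x η` with `u 0 = 0`. Because of the
factorization `D² + (η / 2) D - (η + 7 / 2) = (D - 2) (D + 2 + η / 2)`, fixed points solve the
second-order equation. -/
noncomputable def greenMap (p : ℝ) (x : ℝ → ℝ) (η : ℝ) : ℝ :=
  Real.exp (-(2 * η + η ^ 2 / 4)) * ∫ s in 0..η, Real.exp (2 * s + s ^ 2 / 4) * outer p x s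

lemma outer_eq (hp0 : 0 < p) (hp1 : p < 1) {x : ℝ → ℝ} (hx : Measurable x) (η : ℝ) :
    outer p x η = Real.exp (2 * η) *
      ((∫ s in Ioi 0, Real.exp (-2 * s) * source p s (x s)) -
        ∫ s in 0..η, Real.exp (-2 * s) * source p s (x s)) := by
  rw [outer, ← intervalIntegral.integral_interval_add_Ioi
    (integrableOn_exp_mul_source hp0 hp1 hx 0) (integrableOn_exp_mul_source hp0 hp1 hx η),
    add_sub_cancel_left]

lemma continuous_outer (hp0 : 0 < p) (hp1 : p < 1) {x : ℝ → ℝ} (hx : Measurable x) :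
    Continuous (outer p x) := by
  rw [funext (outer_eq hp0 hp1 hx)]
  have h : Continuous fun η => ∫ s in 0..η, Real.exp (-2 * s) * source p s (x s) := by
    refine intervalIntegral.continuous_primitive (fun a b => ?_) 0
    exact intervalIntegrable_iff.2 ((integrableOn_exp_mul_source hp0 hp1 hx (min a b)).mono_set
      Ioc_subset_Ioi_self)
  fun_prop

lemma hasDerivAt_outer (hp0 : 0 < p) (hp1 : p < 1) {x : ℝ → ℝ} (hx : Continuous x) (η : ℝ) :
    HasDerivAt (outer p x) (2 * outer p x η - source p η (x η)) η := by
  have hF : Continuous fun s => Real.exp (-2 * s) * source p s (x s) :=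
    (by fun_prop : Continuous fun s : ℝ => Real.exp (-2 * s)).mul
      ((continuous_source hp0).comp (continuous_id.prodMk hx))
  have h1 : HasDerivAt (fun η : ℝ => Real.exp (2 * η)) (Real.exp (2 * η) * (2 * 1)) η :=
    ((hasDerivAt_id η).const_mul 2).exp
  have h2 := h1.mul ((hasDerivAt_const η
    (∫ s in Ioi 0, Real.exp (-2 * s) * source p s (x s))).sub (hF.integral_hasStrictDerivAt 0 η).hasDerivAt)
  have h3 : Real.exp (2 * η) * Real.exp (-2 * η) = 1 := by rw [← Real.exp_add]; simp
  refine (h2.congr_of_eventuallyEq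
    (Eventually.of_forall (outer_eq hp0 hp1 hx.measurable))).congr_deriv ?_
  rw [outer_eq hp0 hp1 hx.measurable]
  simp only [Pi.sub_apply]
  linear_combination (-source p η (x η)) * h3

lemma continuous_exp_mul_outer (hp0 : 0 < p) (hp1 : p < 1) {x : ℝ → ℝ} (hx : Measurable x) :
    Continuous fun s => Real.exp (2 * s + s ^ 2 / 4) * outer p x s := by
  have := continuous_outer hp0 hp1 hx
  fun_prop

lemma hasDerivAt_exp_quadratic (η : ℝ) : HasDerivAt (fun s : ℝ => Real.exp (2 * s + s ^ 2 / 4))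
    (Real.exp (2 * η + η ^ 2 / 4) * (2 + η / 2)) η := by
  refine (((hasDerivAt_id η).const_mul 2).add
    (((hasDerivAt_id η).pow 2).div_const 4)).exp.congr_deriv ?_
  simp; ring

lemma hasDerivAt_greenMap (hp0 : 0 < p) (hp1 : p < 1) {x : ℝ → ℝ} (hx : Measurable x) (η : ℝ) :
    HasDerivAt (greenMap p x) (-(2 + η / 2) * greenMap p x η + outer p x η) η := by
  have h1 : HasDerivAt (fun s : ℝ => Real.exp (-(2 * s + s ^ 2 / 4)))
      (Real.exp (-(2 * η + η ^ 2 / 4)) * -(2 + η / 2)) η := by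
    refine (((hasDerivAt_id η).const_mul 2).add
      (((hasDerivAt_id η).pow 2).div_const 4)).neg.exp.congr_deriv ?_
    simp; ring
  have h2 := h1.mul
    ((continuous_exp_mul_outer hp0 hp1 hx).integral_hasStrictDerivAt 0 η).hasDerivAt
  refine h2.congr_deriv ?_
  have h3 : Real.exp (-(2 * η + η ^ 2 / 4)) * Real.exp (2 * η + η ^ 2 / 4) = 1 := by
    rw [← Real.exp_add]; simp
  rw [greenMap]
  linear_combination outer p x η * h3

lemma continuous_greenMap (hp0 : 0 < p) (hp1 : p < 1) {x : ℝ → ℝ} (hx : Measurable x) :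
    Continuous (greenMap p x) :=
  continuous_iff_continuousAt.2 fun η => (hasDerivAt_greenMap hp0 hp1 hx η).continuousAt

lemma outer_mono (hp0 : 0 < p) (hp1 : p < 1) {x y : ℝ → ℝ} (hx : Measurable x)
    (hy : Measurable y) (hxy : ∀ s, 0 ≤ s → x s ≤ y s) {η : ℝ} (hη : 0 ≤ η) :
    outer p x η ≤ outer p y η := by
  refine mul_le_mul_of_nonneg_left (MeasureTheory.setIntegral_mono_on
    (integrableOn_exp_mul_source hp0 hp1 hx η) (integrableOn_exp_mul_source hp0 hp1 hy η)
    measurableSet_Ioi fun s hs => ?_) (Real.exp_pos _).le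
  exact mul_le_mul_of_nonneg_left (source_mono hp0 hp1 s (hxy s (hη.trans (le_of_lt hs))))
    (Real.exp_pos _).le

lemma greenMap_mono (hp0 : 0 < p) (hp1 : p < 1) {x y : ℝ → ℝ} (hx : Measurable x)
    (hy : Measurable y) (hxy : ∀ s, 0 ≤ s → x s ≤ y s) {η : ℝ} (hη : 0 ≤ η) :
    greenMap p x η ≤ greenMap p y η := by
  refine mul_le_mul_of_nonneg_left (intervalIntegral.integral_mono_on hη
    ((continuous_exp_mul_outer hp0 hp1 hx).intervalIntegrable _ _)
    ((continuous_exp_mul_outer hp0 hp1 hy).intervalIntegrable _ _) fun s hs => ?_)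
    (Real.exp_pos _).le
  exact mul_le_mul_of_nonneg_left (outer_mono hp0 hp1 hx hy hxy hs.1) (Real.exp_pos _).le

lemma tendsto_exp_mul_linear :
    Tendsto (fun s : ℝ => Real.exp (-2 * s) * (equilibrium p * (s / 2 + 2))) atTop (𝓝 0) := by
  have h2s : Tendsto (fun s : ℝ => 2 * s) atTop atTop := tendsto_id.const_mul_atTop two_pos
  have h := (((Real.tendsto_pow_mul_exp_neg_atTop_nhds_zero 1).comp h2s).const_mul
    (equilibrium p / 4)).add
      (((Real.tendsto_pow_mul_exp_neg_atTop_nhds_zero 0).comp h2s).const_mul (equilibrium p * 2))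
  simp only [mul_zero, add_zero] at h
  refine h.congr fun s => ?_
  simp only [Function.comp_apply, neg_mul]
  ring

lemma outer_le (hp0 : 0 < p) (hp1 : p < 1) {x : ℝ → ℝ} (hx : Measurable x) {η : ℝ}
    (hη : 0 ≤ η) : outer p x η ≤ equilibrium p * (2 + η / 2) := by
  have hint : ∫ s in Ioi η, Real.exp (-2 * s) * ((|s| + 7 / 2) * equilibrium p) =
      0 - -(Real.exp (-2 * η) * (equilibrium p * (η / 2 + 2))) := by
    refine MeasureTheory.integral_Ioi_of_hasDerivAt_of_tendsto'
      (f := fun s => -(Real.exp (-2 * s) * (equilibrium p * (s / 2 + 2))))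
      (fun s hs => ?_) (integrableOn_exp_mul_linear η) (by simpa using tendsto_exp_mul_linear.neg)
    rw [abs_of_nonneg (hη.trans hs)]
    refine (((hasDerivAt_id s).const_mul (-2)).exp.mul ((((hasDerivAt_id s).div_const 2).add_const
      2).const_mul (equilibrium p))).neg.congr_deriv ?_
    simp only [id]
    ring
  have hle := MeasureTheory.setIntegral_mono (integrableOn_exp_mul_source hp0 hp1 hx η)
    (integrableOn_exp_mul_linear (p := p) η) fun s =>
      mul_le_mul_of_nonneg_left (source_le hp0 hp1 s (x s)) (Real.exp_pos _).le
  have h3 : Real.exp (2 * η) * Real.exp (-2 * η) = 1 := by rw [← Real.exp_add]; simp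
  rw [hint] at hle
  refine (mul_le_mul_of_nonneg_left hle (Real.exp_pos (2 * η)).le).trans (le_of_eq ?_)
  linear_combination (equilibrium p * (2 + η / 2)) * h3

/-- Every value of the operator lies strictly below the equilibrium. -/
lemma greenMap_le (hp0 : 0 < p) (hp1 : p < 1) {x : ℝ → ℝ} (hx : Measurable x) {η : ℝ}
    (hη : 0 ≤ η) :
    greenMap p x η ≤ equilibrium p * (1 - Real.exp (-(2 * η + η ^ 2 / 4))) := by
  have hc : Continuous fun s => Real.exp (2 * s + s ^ 2 / 4) * (2 + s / 2) := by fun_prop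
  have hint : ∫ s in 0..η, Real.exp (2 * s + s ^ 2 / 4) * (2 + s / 2) =
      Real.exp (2 * η + η ^ 2 / 4) - 1 := by
    rw [intervalIntegral.integral_eq_sub_of_hasDerivAt (fun s _ => hasDerivAt_exp_quadratic s)
      (hc.intervalIntegrable _ _)]
    simp
  have hle : ∫ s in 0..η, Real.exp (2 * s + s ^ 2 / 4) * outer p x s ≤
      ∫ s in 0..η, equilibrium p * (Real.exp (2 * s + s ^ 2 / 4) * (2 + s / 2)) := by
    refine intervalIntegral.integral_mono_on hη
      ((continuous_exp_mul_outer hp0 hp1 hx).intervalIntegrable _ _)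
      ((continuous_const.mul hc).intervalIntegrable _ _) fun s hs => ?_
    have := mul_le_mul_of_nonneg_left (outer_le hp0 hp1 hx hs.1) (Real.exp_pos (2 * s + s ^ 2 / 4)).le
    linarith
  rw [intervalIntegral.integral_const_mul, hint] at hle
  refine (mul_le_mul_of_nonneg_left hle (Real.exp_pos _).le).trans (le_of_eq ?_)
  have h3 : Real.exp (-(2 * η + η ^ 2 / 4)) * Real.exp (2 * η + η ^ 2 / 4) = 1 := by
    rw [← Real.exp_add]; simp
  linear_combination equilibrium p * h3

/-- A subsolution: it vanishes at `0`, tends to the equilibrium and satisfies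
`u'' + (η / 2) u' = equilibrium p / 2 * exp (-η² / 4) ≥ 0 ≥ force p u`. -/
noncomputable def barrier (p η : ℝ) : ℝ := equilibrium p * (1 - Real.exp (-(η ^ 2 / 4)))

lemma hasDerivAt_exp_neg_sq (η : ℝ) : HasDerivAt (fun s : ℝ => Real.exp (-(s ^ 2 / 4)))
    (Real.exp (-(η ^ 2 / 4)) * -(η / 2)) η := by
  refine (((hasDerivAt_id η).pow 2).div_const 4).neg.exp.congr_deriv ?_
  simp; ring

lemma barrier_mem (hp1 : p < 1) (η : ℝ) : barrier p η ∈ Icc 0 (equilibrium p) := by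
  have h1 : Real.exp (-(η ^ 2 / 4)) ≤ 1 := Real.exp_le_one_iff.2 (by nlinarith [sq_nonneg η])
  have h2 := Real.exp_pos (-(η ^ 2 / 4))
  have hκ := equilibrium_pos hp1
  exact ⟨mul_nonneg hκ.le (by linarith), by rw [barrier]; nlinarith⟩

/-- The bound is `(D + 2 + η / 2)` applied to the barrier. -/
lemma le_outer (hp0 : 0 < p) (hp1 : p < 1) {x : ℝ → ℝ} (hx : Measurable x)
    (hux : ∀ s, 0 ≤ s → barrier p s ≤ x s) {η : ℝ} (hη : 0 ≤ η) :
    equilibrium p * (2 + η / 2 - 2 * Real.exp (-(η ^ 2 / 4))) ≤ outer p x η := by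
  have hκ := equilibrium_pos hp1
  have hbound : ∀ s, 0 ≤ s →
      0 ≤ (s + 7 / 2) - (s + 4) * Real.exp (-(s ^ 2 / 4)) + 1 / 2 := by
    intro s hs
    have : Real.exp (-(s ^ 2 / 4)) ≤ 1 := Real.exp_le_one_iff.2 (by nlinarith [sq_nonneg s])
    nlinarith
  let D : ℝ → ℝ := fun s =>
    Real.exp (-2 * s) * (equilibrium p * ((s + 7 / 2) - (s + 4) * Real.exp (-(s ^ 2 / 4))))
  have hDint : MeasureTheory.IntegrableOn D (Ioi η) := by
    refine (integrableOn_exp_mul_linear (p := p) η).mono' (by fun_prop) ?_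
    refine (MeasureTheory.ae_restrict_iff' measurableSet_Ioi).2 (Eventually.of_forall fun s hs => ?_)
    have hs0 : 0 ≤ s := hη.trans (le_of_lt hs)
    have h1 := hbound s hs0
    have h2 := Real.exp_pos (-(s ^ 2 / 4))
    rw [Real.norm_eq_abs, abs_mul, Real.abs_exp, abs_of_nonneg hs0, abs_mul, abs_of_pos hκ,
      mul_comm (equilibrium p)]
    refine mul_le_mul_of_nonneg_left (mul_le_mul_of_nonneg_right (abs_le.2 ⟨?_, ?_⟩) hκ.le)
      (Real.exp_pos _).le <;> nlinarith
  have hint : ∫ s in Ioi η, D s = 0 - -(Real.exp (-2 * η) *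
      (equilibrium p * (2 + η / 2 - 2 * Real.exp (-(η ^ 2 / 4))))) := by
    refine MeasureTheory.integral_Ioi_of_hasDerivAt_of_tendsto'
      (f := fun s => -(Real.exp (-2 * s) *
        (equilibrium p * (2 + s / 2 - 2 * Real.exp (-(s ^ 2 / 4))))))
      (fun s _ => ?_) hDint ?_
    · refine (((hasDerivAt_id s).const_mul (-2)).exp.mul (((((hasDerivAt_id s).div_const 2).const_add
        2).sub ((hasDerivAt_exp_neg_sq s).const_mul 2)).const_mul
          (equilibrium p))).neg.congr_deriv ?_
      simp only [id, D, Pi.sub_apply]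
      ring
    · rw [← neg_zero]
      refine Tendsto.neg (squeeze_zero' ?_ ?_ (tendsto_exp_mul_linear (p := p)))
      all_goals
        refine (eventually_ge_atTop 0).mono fun s hs => ?_
        have h1 : Real.exp (-(s ^ 2 / 4)) ≤ 1 :=
          Real.exp_le_one_iff.2 (by nlinarith [sq_nonneg s])
        have h2 := Real.exp_pos (-(s ^ 2 / 4))
      · exact mul_nonneg (Real.exp_pos _).le (mul_nonneg hκ.le (by linarith))
      · exact mul_le_mul_of_nonneg_left (mul_le_mul_of_nonneg_left (by linarith) hκ.le)
          (Real.exp_pos _).le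
  have hle : ∫ s in Ioi η, D s ≤ ∫ s in Ioi η, Real.exp (-2 * s) * source p s (x s) := by
    refine MeasureTheory.setIntegral_mono_on hDint (integrableOn_exp_mul_source hp0 hp1 hx η)
      measurableSet_Ioi fun s hs => mul_le_mul_of_nonneg_left ?_ (Real.exp_pos _).le
    have hs0 : 0 ≤ s := hη.trans (le_of_lt hs)
    have h1 := source_mono hp0 hp1 s (hux s hs0)
    rw [source_of_mem hp0 hs0 (barrier_mem hp1 s)] at h1
    have h2 := force_nonpos hp0 hp1 (barrier_mem hp1 s)
    have h3 := mul_pos hκ (Real.exp_pos (-(s ^ 2 / 4)))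
    have h4 : (s + 7 / 2) * barrier p s = equilibrium p * ((s + 7 / 2) -
      (s + 4) * Real.exp (-(s ^ 2 / 4))) +
        1 / 2 * (equilibrium p * Real.exp (-(s ^ 2 / 4))) := by rw [barrier]; ring
    linarith
  have h3 : Real.exp (2 * η) * Real.exp (-2 * η) = 1 := by rw [← Real.exp_add]; simp
  rw [hint] at hle
  refine le_trans (le_of_eq ?_) (mul_le_mul_of_nonneg_left hle (Real.exp_pos (2 * η)).le)
  linear_combination (-(equilibrium p * (2 + η / 2 - 2 * Real.exp (-(η ^ 2 / 4))))) * h3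

lemma barrier_le_greenMap (hp0 : 0 < p) (hp1 : p < 1) {x : ℝ → ℝ} (hx : Measurable x)
    (hux : ∀ s, 0 ≤ s → barrier p s ≤ x s) {η : ℝ} (hη : 0 ≤ η) :
    barrier p η ≤ greenMap p x η := by
  have hc : Continuous fun s => Real.exp (2 * s + s ^ 2 / 4) *
      (equilibrium p * (2 + s / 2 - 2 * Real.exp (-(s ^ 2 / 4)))) := by fun_prop
  have hint : ∫ s in 0..η, Real.exp (2 * s + s ^ 2 / 4) *
      (equilibrium p * (2 + s / 2 - 2 * Real.exp (-(s ^ 2 / 4)))) =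
      Real.exp (2 * η + η ^ 2 / 4) * barrier p η := by
    rw [intervalIntegral.integral_eq_sub_of_hasDerivAt
      (f := fun s => Real.exp (2 * s + s ^ 2 / 4) * barrier p s) (fun s _ => ?_)
      (hc.intervalIntegrable _ _)]
    · simp [barrier]
    · refine ((hasDerivAt_exp_quadratic s).mul
        (((hasDerivAt_exp_neg_sq s).const_sub 1).const_mul (equilibrium p))).congr_deriv ?_
      ring
  have hle := intervalIntegral.integral_mono_on (μ := MeasureTheory.volume) hη
    (hc.intervalIntegrable _ _)
    ((continuous_exp_mul_outer hp0 hp1 hx).intervalIntegrable 0 η) fun s hs =>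
      mul_le_mul_of_nonneg_left (le_outer hp0 hp1 hx hux hs.1)
        (Real.exp_pos (2 * s + s ^ 2 / 4)).le
  rw [hint] at hle
  refine le_trans (le_of_eq ?_) (mul_le_mul_of_nonneg_left hle (Real.exp_pos _).le)
  have h3 : Real.exp (-(2 * η + η ^ 2 / 4)) * Real.exp (2 * η + η ^ 2 / 4) = 1 := by
    rw [← Real.exp_add]; simp
  linear_combination (-barrier p η) * h3

end operator

/-! ### Existence of a connecting solution -/

section existence

variable {p : ℝ}

lemma tendsto_outer (hp0 : 0 < p) (hp1 : p < 1) {x : ℕ → ℝ → ℝ} {y : ℝ → ℝ}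
    (hx : ∀ n, Measurable (x n))
    (hlim : ∀ s, 0 ≤ s → Tendsto (fun n => x n s) atTop (𝓝 (y s))) {η : ℝ} (hη : 0 ≤ η) :
    Tendsto (fun n => outer p (x n) η) atTop (𝓝 (outer p y η)) := by
  refine Tendsto.const_mul _ (MeasureTheory.tendsto_integral_filter_of_dominated_convergence _
    (Eventually.of_forall fun n =>
      (integrableOn_exp_mul_source hp0 hp1 (hx n) η).aestronglyMeasurable)
    (Eventually.of_forall fun n => Eventually.of_forall fun s => ?_)
    (integrableOn_exp_mul_linear (p := p) η)
    ((MeasureTheory.ae_restrict_iff' measurableSet_Ioi).2 (Eventually.of_forall fun s hs => ?_)))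
  · rw [Real.norm_eq_abs, abs_mul, Real.abs_exp, abs_of_nonneg (source_nonneg hp0 hp1 _ _)]
    exact mul_le_mul_of_nonneg_left (source_le hp0 hp1 _ _) (Real.exp_pos _).le
  · have hc : Continuous (source p s) := (continuous_source hp0).comp (by fun_prop :
      Continuous fun x : ℝ => (s, x))
    exact ((hc.tendsto _).comp (hlim s (hη.trans (le_of_lt hs)))).const_mul _

lemma outer_nonneg (hp0 : 0 < p) (hp1 : p < 1) (x : ℝ → ℝ) (η : ℝ) : 0 ≤ outer p x η :=
  mul_nonneg (Real.exp_pos _).le (MeasureTheory.setIntegral_nonneg measurableSet_Ioi fun _ _ =>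
    mul_nonneg (Real.exp_pos _).le (source_nonneg hp0 hp1 _ _))

lemma tendsto_greenMap (hp0 : 0 < p) (hp1 : p < 1) {x : ℕ → ℝ → ℝ} {y : ℝ → ℝ}
    (hx : ∀ n, Measurable (x n))
    (hlim : ∀ s, 0 ≤ s → Tendsto (fun n => x n s) atTop (𝓝 (y s))) {η : ℝ} (hη : 0 ≤ η) :
    Tendsto (fun n => greenMap p (x n) η) atTop (𝓝 (greenMap p y η)) := by
  have hc : Continuous fun s => Real.exp (2 * s + s ^ 2 / 4) *
      (equilibrium p * (2 + s / 2)) := by fun_prop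
  refine Tendsto.const_mul _ (intervalIntegral.tendsto_integral_filter_of_dominated_convergence
    (fun s => Real.exp (2 * s + s ^ 2 / 4) * (equilibrium p * (2 + s / 2)))
    (Eventually.of_forall fun n => (continuous_exp_mul_outer hp0 hp1 (hx n)).aestronglyMeasurable)
    (Eventually.of_forall fun n => Eventually.of_forall fun _ hs => ?_)
    (hc.intervalIntegrable _ _) (Eventually.of_forall fun s hs => ?_))
  all_goals rw [uIoc_of_le hη] at hs
  · rw [Real.norm_eq_abs, abs_mul, Real.abs_exp, abs_of_nonneg (outer_nonneg hp0 hp1 _ _)]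
    exact mul_le_mul_of_nonneg_left (outer_le hp0 hp1 (hx n) hs.1.le) (Real.exp_pos _).le
  · exact (tendsto_outer hp0 hp1 hx hlim hs.1.le).const_mul _

lemma outer_congr {x y : ℝ → ℝ} (h : ∀ s, 0 ≤ s → x s = y s) {η : ℝ} (hη : 0 ≤ η) :
    outer p x η = outer p y η := by
  rw [outer, outer, MeasureTheory.setIntegral_congr_fun measurableSet_Ioi fun s hs => ?_]
  simp only [h s (hη.trans (le_of_lt hs))]

lemma greenMap_congr {x y : ℝ → ℝ} (h : ∀ s, 0 ≤ s → x s = y s) {η : ℝ} (hη : 0 ≤ η) :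
    greenMap p x η = greenMap p y η := by
  rw [greenMap, greenMap, intervalIntegral.integral_congr fun s hs => ?_]
  rw [uIcc_of_le hη] at hs
  simp only [outer_congr h hs.1]

/-- Iterating the operator from the constant supersolution `equilibrium p` gives a decreasing
sequence above the barrier; its limit is a fixed point on `[0, ∞)`. -/
lemma exists_fixedPoint (hp0 : 0 < p) (hp1 : p < 1) :
    ∃ x : ℝ → ℝ, Continuous x ∧ (∀ η, 0 ≤ η → greenMap p x η = x η) ∧
      ∀ η, 0 ≤ η → barrier p η ≤ x η := by
  let u : ℕ → ℝ → ℝ := fun n => (greenMap p)^[n] fun _ => equilibrium p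
  have hsucc : ∀ n, u (n + 1) = greenMap p (u n) := fun n =>
    Function.iterate_succ_apply' _ _ _
  have hmeas : ∀ n, Measurable (u n) := by
    intro n
    induction n with
    | zero => exact measurable_const
    | succ n ih => rw [hsucc]; exact (continuous_greenMap hp0 hp1 ih).measurable
  have hlow : ∀ n, ∀ η, 0 ≤ η → barrier p η ≤ u n η := by
    intro n
    induction n with
    | zero => exact fun η _ => (barrier_mem hp1 η).2
    | succ n ih => rw [hsucc]; exact fun η hη => barrier_le_greenMap hp0 hp1 (hmeas n) ih hη
  have hstep : ∀ n, ∀ η, 0 ≤ η → u (n + 1) η ≤ u n η := by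
    intro n
    induction n with
    | zero =>
      intro η hη
      rw [hsucc]
      refine (greenMap_le hp0 hp1 (hmeas 0) hη).trans ?_
      exact mul_le_of_le_one_right (equilibrium_pos hp1).le
        (by linarith [Real.exp_pos (-(2 * η + η ^ 2 / 4))])
    | succ n ih =>
      intro η hη
      rw [hsucc, hsucc n]
      exact greenMap_mono hp0 hp1 (hsucc n ▸ hmeas (n + 1)) (hmeas n) (hsucc n ▸ ih) hη
  let v : ℝ → ℝ := fun η => ⨅ n, u n η
  have hv : Measurable v := Measurable.iInf hmeas
  have hlim : ∀ η, 0 ≤ η → Tendsto (fun n => u n η) atTop (𝓝 (v η)) := fun η hη =>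
    tendsto_atTop_ciInf (antitone_nat_of_succ_le fun n => hstep n η hη)
      ⟨barrier p η, by rintro _ ⟨n, rfl⟩; exact hlow n η hη⟩
  have hfix : ∀ η, 0 ≤ η → greenMap p v η = v η := by
    intro η hη
    have h1 := tendsto_greenMap hp0 hp1 hmeas hlim hη
    have h2 := (hlim η hη).comp (tendsto_add_atTop_nat 1)
    refine tendsto_nhds_unique h1 (h2.congr fun n => ?_)
    simp only [Function.comp_apply, hsucc]
  -- the image of `v` agrees with `v` on `[0, ∞)` and is continuous on all of `ℝ`
  refine ⟨greenMap p v, continuous_greenMap hp0 hp1 hv, fun η hη => greenMap_congr hfix hη,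
    fun η hη => ?_⟩
  rw [hfix η hη]
  exact ge_of_tendsto' (hlim η hη) fun n => hlow n η hη

/-- A fixed point yields a classical solution lying between the barrier and the equilibrium. -/
lemma exists_solution (hp0 : 0 < p) (hp1 : p < 1) :
    ∃ x y : ℝ → ℝ, x 0 = 0 ∧ (∀ η, 0 ≤ η → HasDerivAt x (y η) η) ∧
      (∀ η, 0 ≤ η → HasDerivAt y (force p (x η) - 1 / 2 * η * y η) η) ∧
      ∀ η, 0 ≤ η → barrier p η ≤ x η ∧ x η < equilibrium p := by
  obtain ⟨x, hx, hfix, hlow⟩ := exists_fixedPoint hp0 hp1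
  have hκ := equilibrium_pos hp1
  have hup : ∀ η, 0 ≤ η → x η < equilibrium p := by
    intro η hη
    rw [← hfix η hη]
    refine (greenMap_le hp0 hp1 hx.measurable hη).trans_lt ?_
    exact mul_lt_of_lt_one_right hκ (by linarith [Real.exp_pos (-(2 * η + η ^ 2 / 4))])
  have hX := hasDerivAt_greenMap hp0 hp1 hx.measurable
  refine ⟨greenMap p x, fun η => -(2 + η / 2) * greenMap p x η + outer p x η,
    by simp [greenMap], fun η _ => hX η, fun η hη => ?_, fun η hη => ?_⟩
  · have h1 : HasDerivAt (fun η : ℝ => -(2 + η / 2)) (-(1 / 2)) η :=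
      (((hasDerivAt_id η).div_const 2).const_add 2).neg
    refine ((h1.mul (hX η)).add (hasDerivAt_outer hp0 hp1 hx η)).congr_deriv ?_
    rw [source_of_mem hp0 hη ⟨(barrier_mem hp1 η).1.trans (hlow η hη), (hup η hη).le⟩]
    simp only [hfix η hη]
    ring
  · rw [hfix η hη]
    exact ⟨hlow η hη, hup η hη⟩

lemma tendsto_exp_neg_sq :
    Tendsto (fun η : ℝ => Real.exp (-(η ^ 2 / 4))) atTop (𝓝 0) :=
  Real.tendsto_exp_neg_atTop_nhds_zero.comp
    ((tendsto_pow_atTop two_ne_zero).atTop_div_const (by norm_num))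

lemma tendsto_barrier : Tendsto (barrier p) atTop (𝓝 (equilibrium p)) := by
  have h := (tendsto_exp_neg_sq.const_sub 1).const_mul (equilibrium p)
  rwa [sub_zero, mul_one] at h

lemma setE3_nonempty (hp0 : 0 < p) (hp1 : p < 1) : (setE3 p).Nonempty := by
  obtain ⟨x, y, hx0, hx, hy, hxm⟩ := exists_solution hp0 hp1
  have hκ := equilibrium_pos hp1
  have hpos : ∀ η, 0 < η → 0 < x η := fun η hη => by
    refine lt_of_lt_of_le (mul_pos hκ (sub_pos.2 (Real.exp_lt_one_iff.2 ?_))) (hxm η hη.le).1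
    have := pow_pos hη 2
    linarith
  have hxlim : Tendsto x atTop (𝓝 (equilibrium p)) :=
    tendsto_of_tendsto_of_tendsto_of_le_of_le' tendsto_barrier tendsto_const_nhds
      ((eventually_ge_atTop 0).mono fun η hη => (hxm η hη).1)
      ((eventually_ge_atTop 0).mono fun η hη => (hxm η hη).2.le)
  -- `(exp (η² / 4) y)' = exp (η² / 4) force p x ≤ 0`
  have hanti : AntitoneOn (fun η => Real.exp (η ^ 2 / 4) * y η) (Ici 0) := by
    have hd : ∀ η, 0 ≤ η → HasDerivAt (fun η => Real.exp (η ^ 2 / 4) * y η)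
        (Real.exp (η ^ 2 / 4) * force p (x η)) η := by
      intro η hη
      have hexp : HasDerivAt (fun η : ℝ => Real.exp (η ^ 2 / 4))
          (Real.exp (η ^ 2 / 4) * (η / 2)) η := by
        refine (((hasDerivAt_id η).pow 2).div_const 4).exp.congr_deriv ?_
        simp; ring
      exact (hexp.mul (hy η hη)).congr_deriv (by ring)
    refine antitoneOn_of_deriv_nonpos (convex_Ici _)
      (fun η hη => (hd η hη).continuousAt.continuousWithinAt) ?_ ?_ <;> rw [interior_Ici] <;>
      intro η hη
    · exact (hd η (le_of_lt hη)).differentiableAt.differentiableWithinAt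
    · rw [(hd η (le_of_lt hη)).deriv]
      exact mul_nonpos_of_nonneg_of_nonpos (Real.exp_pos _).le
        (force_nonpos hp0 hp1 ⟨(hpos η hη).le, (hxm η (le_of_lt hη)).2.le⟩)
  -- once `y ≤ 0`, the first component decreases from then on and misses the equilibrium
  have hypos : ∀ η, 0 ≤ η → 0 < y η := by
    intro a ha
    by_contra! hle
    have hneg : ∀ η, a ≤ η → y η ≤ 0 := fun η hη => by
      have h1 := hanti ha (ha.trans hη) hη
      have h2 : Real.exp (a ^ 2 / 4) * y a ≤ 0 :=
        mul_nonpos_of_nonneg_of_nonpos (Real.exp_pos _).le hle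
      exact nonpos_of_mul_nonpos_right (h1.trans h2) (Real.exp_pos _)
    have hxanti : AntitoneOn x (Ici a) := by
      refine antitoneOn_of_deriv_nonpos (convex_Ici _)
        (fun η hη => (hx η (ha.trans hη)).continuousAt.continuousWithinAt) ?_ ?_ <;>
        rw [interior_Ici] <;> intro η hη
      · exact (hx η (ha.trans (le_of_lt hη))).differentiableAt.differentiableWithinAt
      · rw [(hx η (ha.trans (le_of_lt hη))).deriv]
        exact hneg η (le_of_lt hη)
    have := le_of_tendsto hxlim ((eventually_ge_atTop a).mono fun η hη =>
      hxanti self_mem_Ici hη hη)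
    exact absurd (hxm a ha).2 (not_lt.2 this)
  have hyle : ∀ η, 0 ≤ η → y η ≤ y 0 * Real.exp (-(η ^ 2 / 4)) := by
    intro η hη
    have h1 := hanti self_mem_Ici hη hη
    simp only [ne_eq, OfNat.ofNat_ne_zero, not_false_eq_true, zero_pow, zero_div, Real.exp_zero,
      one_mul] at h1
    rw [Real.exp_neg, ← div_eq_mul_inv, le_div_iff₀ (Real.exp_pos _)]
    linarith
  have hylim : Tendsto y atTop (𝓝 0) := by
    have h := tendsto_exp_neg_sq.const_mul (y 0)
    rw [mul_zero] at h
    exact squeeze_zero' ((eventually_ge_atTop 0).mono fun η hη => (hypos η hη).le)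
      ((eventually_ge_atTop 0).mono hyle) h
  have hq : ((0, y 0) : ℝ × ℝ) ∈ halfLine := ⟨rfl, hypos 0 le_rfl⟩
  have hsol : IsSolutionOn p (Ici 0) (0, y 0) fun η => (x η, y η) := by
    refine ⟨by simp [hx0], fun η hη => ((hx η hη).prodMk (hy η hη)).hasDerivWithinAt, ?_⟩
    refine ((Metric.isBounded_Icc 0 (equilibrium p)).prod
      (Metric.isBounded_Icc 0 (y 0))).subset ?_
    rintro _ ⟨η, hη, rfl⟩
    refine ⟨⟨(barrier_mem hp1 η).1.trans (hxm η hη).1, (hxm η hη).2.le⟩, (hypos η hη).le,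
      (hyle η hη).trans (mul_le_of_le_one_right (hypos 0 le_rfl).le ?_)⟩
    exact Real.exp_le_one_iff.2 (by nlinarith [sq_nonneg η])
  have hΩ : ∀ η, 0 < η → (x η, y η) ∈ regionOmega p := fun η hη =>
    ⟨hpos η hη, (hxm η hη.le).2, hypos η hη.le⟩
  exact ⟨(0, y 0), hq, _, hsol, fun T hT z' hz' =>
    solution_unique hp0 hp1 hT (hsol.mono fun η hη => hη.1) hq (fun η hη => hΩ η hη.1) hz',
    hΩ, hxlim.prodMk_nhds hylim⟩

end existence

theorem corollary4p10 (p : ℝ) (hp0 : 0 < p) (hp1 : p < 1) :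
    (setE3 p).Nonempty ∧ setE3 p ⊆ halfLine ∧
      IsClosed ((Subtype.val : halfLine → ℝ × ℝ) ⁻¹' setE3 p) :=
  ⟨setE3_nonempty hp0 hp1, fun _ hq => hq.1,
    (setE3_subsingleton hp1).finite.isClosed.preimage continuous_subtype_val⟩
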